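/- Let $\mathscr{H}$ be a complex Hilbert space of arbitrary dimension and let $\mathbb{B}(\mathscr{H})$ be the algebra of bounded linear operators on $\mathscr{H}$. A unitarily invariant norm $|||\cdot|||$ is a norm on a two-sided ideal $\mathfrak{J}_{|||\cdot|||}$ of $\mathbb{B}(\mathscr{H})$ (its norm ideal) such that $|||UXV||| = |||X|||$ for all unitary operators $U,V\in\mathbb{B}(\mathscr{H})$ and all $X\in\mathfrak{J}_{|||\cdot|||}$. Let $P,Q\in\mathbb{B}(\mathscr{H})$ be invertible positive operators and let $t\le 2$ be a real number. Then for every unitarily invariant norm $|||\cdot|||$ and every $X\in\mathfrak{J}_{|||\cdot|||}$, $$|||PXQ^{-1}+P^{-1}XQ+tX|||\ \ge\ (t+2)\,|||X|||.$$ -/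

import Mathlib

/-- A unitarily invariant norm on operators of a complex Hilbert space `H`: a two-sided ideal
`ideal` of the algebra of bounded operators on `H` together with a norm on this complex vector
space such that `|||U X V||| = |||X|||` for all unitaries `U`, `V` and all `X` in the ideal. -/
structure UnitarilyInvariantNorm (H : Type*) [NormedAddCommGroup H] [InnerProductSpace ℂ H]
    [CompleteSpace H] where
  /-- the norm ideal on which the norm lives -/
  ideal : Submodule ℂ (H →L[ℂ] H)
  mul_mem_left : ∀ (A : H →L[ℂ] H) {X : H →L[ℂ] H}, X ∈ ideal → A * X ∈ ideal
  mul_mem_right : ∀ {X : H →L[ℂ] H} (B : H →L[ℂ] H), X ∈ ideal → X * B ∈ ideal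
  /-- the norm: a seminorm which is definite by the next field -/
  toSeminorm : Seminorm ℂ ideal
  eq_zero_of_apply_eq_zero : ∀ X : ideal, toSeminorm X = 0 → X = 0
  apply_unitary_mul_mul_unitary : ∀ U ∈ unitary (H →L[ℂ] H), ∀ V ∈ unitary (H →L[ℂ] H),
    ∀ X : ideal,
      toSeminorm ⟨U * (X : H →L[ℂ] H) * V, mul_mem_right V (mul_mem_left U X.2)⟩ = toSeminorm X

namespace UnitarilyInvariantNorm

/-- `N X` is the norm of an element `X` of the norm ideal of `N`. -/
noncomputable instance instCoeFun {H : Type*} [NormedAddCommGroup H] [InnerProductSpace ℂ H]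
    [CompleteSpace H] : CoeFun (UnitarilyInvariantNorm H) (fun N => N.ideal → ℝ) :=
  ⟨fun N => ⇑N.toSeminorm⟩

/-- For `X` in the norm ideal of `N`, the operator `A X B` as an element of that ideal. -/
def mulMul {H : Type*} [NormedAddCommGroup H] [InnerProductSpace ℂ H] [CompleteSpace H]
    (N : UnitarilyInvariantNorm H) (A : H →L[ℂ] H) (X : N.ideal) (B : H →L[ℂ] H) : N.ideal :=
  ⟨A * (X : H →L[ℂ] H) * B, N.mul_mem_right B (N.mul_mem_left A X.2)⟩

end UnitarilyInvariantNorm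

/-!
Left multiplication by `A` and right multiplication by `B` are bounded on the norm ideal, because
every operator is a combination of four unitaries with coefficients controlled by its norm
(`NormIdeal.norm_leftMulBilin_le`, `NormIdeal.norm_rightMulBilin_le`). Write `P = exp (2 a)` and
`Q = exp (2 b)` with `a`, `b` self-adjoint, and set `f z X = exp (z a) X exp (-z b)`
(`NormIdeal.expFlow`). This is a family of bounded operators on the norm ideal with
`f (z + w) = f z ∘ f w`, differentiable at `0` with derivative `D X = a X - X b`, and isometric for
imaginary `z` by unitary invariance. As `P X Q⁻¹ + P⁻¹ X Q + 2 X` is the square of `f 1 + f (-1)`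
applied to `X`, the case `t = 2` follows from `‖f 1 X + f (-1) X‖ ≥ 2 ‖X‖`
(`two_mul_norm_le_norm_add`), and smaller `t` from the triangle inequality.

Formally `f 1 + f (-1) = 2 cosh D`, and `cosh` is a product of factors with purely imaginary zeros.
If `r` is imaginary then `‖(D - r) X‖ ≥ ‖r‖ ‖X‖`, because the norm of `exp (-z r) f z X`
changes at rate `‖r‖ ‖X‖` as `z` moves along the imaginary axis
(`norm_mul_norm_le_norm_sub_smul`). Hence `‖g(D) X‖ ≥ ‖g(0)‖ ‖X‖` for every polynomial `g` all of
whose zeros are imaginary (`norm_eval_zero_mul_le_norm_aeval`). The polynomials `(1 + z/m)^m + (1 - z/m)^m` have this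
property, because `|1 + z/m| = |1 - z/m|` forces `z` to be imaginary, and at `D` they tend to
`f 1 + f (-1)`. Neither completeness of the norm ideal nor a spectral theorem for `D` is needed.
-/

open Filter Topology Polynomial

/-! ### Exponential limits in a normed algebra -/

theorem norm_pow_sub_pow_le {𝔸 : Type*} [NormedRing 𝔸] [NormOneClass 𝔸] {x y : 𝔸} {M : ℝ}
    (hM : 1 ≤ M) (hx : ‖x‖ ≤ M) (hy : ‖y‖ ≤ M) (n : ℕ) :
    ‖x ^ n - y ^ n‖ ≤ n * M ^ n * ‖x - y‖ := by
  induction n with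
  | zero => simp
  | succ n ih =>
    have h : x ^ (n + 1) - y ^ (n + 1) = x * (x ^ n - y ^ n) + (x - y) * y ^ n := by
      rw [pow_succ', pow_succ']; noncomm_ring
    have hyn : ‖y ^ n‖ ≤ M ^ n := (norm_pow_le y n).trans (by gcongr)
    have hMn : M ^ n ≤ M ^ (n + 1) := pow_le_pow_right₀ hM n.le_succ
    calc ‖x ^ (n + 1) - y ^ (n + 1)‖
        ≤ ‖x‖ * ‖x ^ n - y ^ n‖ + ‖x - y‖ * ‖y ^ n‖ := by
          rw [h]; exact (norm_add_le _ _).trans (add_le_add (norm_mul_le _ _) (norm_mul_le _ _))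
      _ ≤ M * (n * M ^ n * ‖x - y‖) + ‖x - y‖ * M ^ (n + 1) := by
          gcongr
          exact hyn.trans hMn
      _ = (n + 1 : ℕ) * M ^ (n + 1) * ‖x - y‖ := by push_cast; ring

/-- If `f z = 1 + z D + o(z)`, then `f (c/m) ^ m` and `(1 + (c/m) D) ^ m` are asymptotically
equal. -/
theorem tendsto_pow_sub_one_add_pow {𝔸 : Type*} [NormedRing 𝔸] [NormOneClass 𝔸]
    [NormedAlgebra ℂ 𝔸] {f : ℂ → 𝔸} {D : 𝔸} (hf : HasDerivAt f D 0) (h0 : f 0 = 1) (c : ℂ) :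
    Tendsto (fun m : ℕ => f (c / m) ^ m - (1 + (c / m) • D) ^ m) atTop (𝓝 0) := by
  have hc : Tendsto (fun m : ℕ => c / (m : ℂ)) atTop (𝓝 0) :=
    tendsto_const_div_atTop_nhds_zero_nat c
  have ho : (fun m : ℕ => f (c / m) - (1 + (c / m) • D)) =o[atTop] fun m : ℕ => c / (m : ℂ) := by
    have h := (hasDerivAt_iff_isLittleO.1 hf).comp_tendsto hc
    refine (h.congr_left fun m => ?_).congr_right fun m => ?_
    · simp [h0, sub_sub]
    · simp
  set K : ℝ := ‖c‖ * (‖D‖ + 1) with hK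
  have hK0 : 0 ≤ K := by positivity
  rw [Metric.tendsto_atTop]
  intro ε hε
  obtain ⟨δ, hδ0, hδ1, hδ⟩ : ∃ δ : ℝ, 0 < δ ∧ δ ≤ 1 ∧ Real.exp K * (δ * ‖c‖) < ε := by
    have hpos : 0 < Real.exp K * ‖c‖ + 1 := by positivity
    refine ⟨min 1 (ε / (Real.exp K * ‖c‖ + 1)), by positivity, min_le_left _ _, ?_⟩
    have h1 := min_le_right 1 (ε / (Real.exp K * ‖c‖ + 1))
    have h2 : 0 < min 1 (ε / (Real.exp K * ‖c‖ + 1)) := by positivity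
    rw [le_div_iff₀ hpos] at h1
    nlinarith
  obtain ⟨m₀, hm₀⟩ := eventually_atTop.1 ((ho.bound hδ0).and (eventually_gt_atTop 0))
  refine ⟨m₀, fun m hm => ?_⟩
  obtain ⟨hb, hmpos⟩ := hm₀ m hm
  have hm' : (0 : ℝ) < m := by exact_mod_cast hmpos
  have hcm : ‖c / (m : ℂ)‖ = ‖c‖ / m := by simp
  rw [hcm] at hb
  have hlin : ‖1 + (c / (m : ℂ)) • D‖ ≤ 1 + ‖c‖ / m * ‖D‖ := by
    refine (norm_add_le _ _).trans ?_
    rw [norm_one, norm_smul, hcm]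
  have hcm0 : 0 ≤ ‖c‖ / m := by positivity
  have hM : K / m = ‖c‖ / m * ‖D‖ + ‖c‖ / m := by rw [hK]; ring
  have hy : ‖1 + (c / (m : ℂ)) • D‖ ≤ 1 + K / m := by linarith
  have hx : ‖f (c / m)‖ ≤ 1 + K / m := by
    have h1 := norm_le_insert' (f (c / m)) (1 + (c / (m : ℂ)) • D)
    nlinarith
  have hexp : (1 + K / m) ^ m ≤ Real.exp K := by
    calc (1 + K / m) ^ m ≤ Real.exp (K / m) ^ m := by
          gcongr
          linarith [Real.add_one_le_exp (K / m)]
      _ = Real.exp K := by rw [← Real.exp_nat_mul]; congr 1; field_simp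
  rw [dist_zero_right]
  calc _ ≤ m * (1 + K / m) ^ m * ‖f (c / m) - (1 + (c / (m : ℂ)) • D)‖ :=
        norm_pow_sub_pow_le (by linarith [div_nonneg hK0 hm'.le]) hx hy m
    _ ≤ m * Real.exp K * (δ * (‖c‖ / m)) := by gcongr
    _ = Real.exp K * (δ * ‖c‖) := by field_simp
    _ < ε := hδ

/-! ### Generators of isometric groups -/

section Generator

variable {E : Type*} [NormedAddCommGroup E] [NormedSpace ℂ E]

/-- If `f` is differentiable at `0` with derivative `D` and isometric on the imaginary axis, then
`‖(D - r) x‖ ≥ ‖r‖ ‖x‖` for `r` purely imaginary. -/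
theorem norm_mul_norm_le_norm_sub_smul {f : ℂ → E →L[ℂ] E} {D : E →L[ℂ] E}
    (hf : HasDerivAt f D 0) (h0 : f 0 = 1)
    (hiso : ∀ (s : ℝ) (x : E), ‖f (s * Complex.I) x‖ = ‖x‖) {r : ℂ} (hr : r.re = 0) (x : E) :
    ‖r‖ * ‖x‖ ≤ ‖D x - r • x‖ := by
  obtain ⟨ρ, rfl⟩ : ∃ ρ : ℝ, r = ρ * Complex.I := ⟨r.im, by apply Complex.ext <;> simp [hr]⟩
  -- The curve `s ↦ exp (ρ s) f (i s) x` has norm `exp (ρ s) ‖x‖` and derivative `i (D - i ρ) x`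
  -- at `0`; the norm cannot change faster than the curve.
  set g : ℝ → E := fun s => Real.exp (ρ * s) • f (s * Complex.I) x with hg
  have hfx : HasDerivAt (fun s : ℝ => f (s * Complex.I) x) (Complex.I • D x) 0 := by
    have h1 : HasDerivAt (fun s : ℝ => (s : ℂ) * Complex.I) Complex.I 0 := by
      simpa using (Complex.ofRealCLM.hasDerivAt (x := (0 : ℝ))).mul_const Complex.I
    have h2 : HasDerivAt f D (((0 : ℝ) : ℂ) * Complex.I) := by simpa using hf
    have h3 := h2.scomp (0 : ℝ) h1
    have h4 := ((ContinuousLinearMap.apply ℂ E x).restrictScalars ℝ).hasFDerivAt.comp_hasDerivAt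
      (0 : ℝ) h3
    simpa [Function.comp_def] using h4
  have hexp : HasDerivAt (fun s : ℝ => Real.exp (ρ * s)) ρ 0 := by
    simpa using ((hasDerivAt_id (0 : ℝ)).const_mul ρ).exp
  have hgd : HasDerivAt g (Complex.I • (D x - (ρ * Complex.I) • x)) 0 := by
    refine (hexp.smul hfx).congr_deriv ?_
    simp only [h0, mul_zero, Real.exp_zero, one_smul, Complex.ofReal_zero, zero_mul,
      one_apply_eq_self, smul_sub, smul_smul]
    rw [show Complex.I * (ρ * Complex.I) = -(ρ : ℂ) by
      linear_combination (ρ : ℂ) * Complex.I_mul_I]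
    simp
  have hnorm : ∀ s, ‖g s‖ = Real.exp (ρ * s) * ‖x‖ := fun s => by
    rw [hg]; simp [norm_smul, hiso]
  have hnd : HasDerivAt (fun s => ‖g s‖) (ρ * ‖x‖) 0 := by
    simp only [hnorm]
    exact hexp.mul_const _
  have hlim1 := (hasDerivAt_iff_tendsto_slope.1 hnd).norm
  have hlim2 := (hasDerivAt_iff_tendsto_slope.1 hgd).norm
  have hle := le_of_tendsto_of_tendsto' hlim1 hlim2 fun s => by
    simp only [slope_def_module, norm_smul]
    gcongr
    exact abs_norm_sub_norm_le _ _
  simpa [norm_smul] using hle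

/-- A lower bound `‖(D - r) x‖ ≥ ‖r‖ ‖x‖` for imaginary `r` extends multiplicatively to all
polynomials with imaginary roots. -/
theorem norm_eval_zero_mul_le_norm_aeval {D : E →L[ℂ] E}
    (hD : ∀ r : ℂ, r.re = 0 → ∀ x : E, ‖r‖ * ‖x‖ ≤ ‖D x - r • x‖)
    {p : ℂ[X]} (hp : ∀ r ∈ p.roots, r.re = 0) (x : E) :
    ‖p.eval 0‖ * ‖x‖ ≤ ‖aeval D p x‖ := by
  let Good : ℂ[X] → Prop := fun q => ∀ x : E, ‖q.eval 0‖ * ‖x‖ ≤ ‖aeval D q x‖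
  have hmul : ∀ q₁ q₂, Good q₁ → Good q₂ → Good (q₁ * q₂) := by
    intro q₁ q₂ h₁ h₂ x
    rw [eval_mul, norm_mul, map_mul, mul_apply_eq_comp, mul_assoc]
    exact (mul_le_mul_of_nonneg_left (h₂ x) (norm_nonneg _)).trans (h₁ _)
  have hC : ∀ a : ℂ, Good (C a) := fun a x => by
    simp [Algebra.algebraMap_eq_smul_one, norm_smul]
  have hX : ∀ r : ℂ, r.re = 0 → Good (X - C r) := fun r hr x => by
    simpa [Algebra.algebraMap_eq_smul_one] using hD r hr x
  have hgood : Good p := by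
    rw [(IsAlgClosed.splits p).eq_prod_roots]
    refine hmul _ _ (hC _) (Multiset.prod_induction Good _ hmul (by simpa using hC 1) ?_)
    intro q hq
    obtain ⟨r, hr, rfl⟩ := Multiset.mem_map.1 hq
    exact hX r (hp r hr)
  exact hgood x

/-- The zeros of `(1 + z/m)^m + (1 - z/m)^m` satisfy `|1 + z/m| = |1 - z/m|`, that is,
they are equidistant from `m` and `-m`. -/
theorem re_eq_zero_of_mem_roots {m : ℕ} (hm : m ≠ 0) {r : ℂ}
    (hr : r ∈ (((1 + C (1 / (m : ℂ)) * X) ^ m + (1 + C (-1 / (m : ℂ)) * X) ^ m) : ℂ[X]).roots) :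
    r.re = 0 := by
  have h := (mem_roots'.1 hr).2
  simp only [IsRoot.def, eval_add, eval_pow, eval_one, eval_mul, eval_C, eval_X] at h
  have h2 := congrArg norm (eq_neg_of_add_eq_zero_left h)
  rw [norm_neg, norm_pow, norm_pow] at h2
  have h3 := (pow_left_inj₀ (norm_nonneg _) (norm_nonneg _) hm).1 h2
  have h4 := congrArg (· ^ 2) h3
  have hm' : (m : ℝ) ≠ 0 := by exact_mod_cast hm
  have e1 : 1 / (m : ℂ) * r = ((1 / (m : ℝ) : ℝ) : ℂ) * r := by push_cast; rfl
  have e2 : -1 / (m : ℂ) * r = ((-1 / (m : ℝ) : ℝ) : ℂ) * r := by push_cast; rfl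
  rw [e1, e2] at h4
  simp only [Complex.sq_norm, Complex.normSq_apply, Complex.add_re, Complex.add_im, Complex.one_re,
    Complex.one_im, Complex.re_ofReal_mul, Complex.im_ofReal_mul] at h4
  have h5 : 1 / (m : ℝ) * r.re = 0 := by linear_combination h4 / 4
  simpa [hm'] using h5

/-- The inequality `‖2 cosh(D) x‖ ≥ 2 ‖x‖` for the generator `D` of a group that is isometric on
the imaginary axis. -/
theorem two_mul_norm_le_norm_add {f : ℂ → E →L[ℂ] E} {D : E →L[ℂ] E}
    (hf : HasDerivAt f D 0) (h0 : f 0 = 1) (hpow : ∀ (n : ℕ) (z : ℂ), f (n * z) = f z ^ n)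
    (hiso : ∀ (s : ℝ) (x : E), ‖f (s * Complex.I) x‖ = ‖x‖) (x : E) :
    2 * ‖x‖ ≤ ‖f 1 x + f (-1) x‖ := by
  rcases subsingleton_or_nontrivial E with hE | hE
  · simp [Subsingleton.elim x 0]
  have hlim : ∀ c : ℂ, Tendsto (fun m : ℕ => ((1 + (c / m) • D) ^ m) x) atTop (𝓝 (f c x)) := by
    intro c
    have h1 := (ContinuousLinearMap.apply ℂ E x).continuous.tendsto 0 |>.comp
      (tendsto_pow_sub_one_add_pow hf h0 c)
    have h2 := (tendsto_const_nhds (x := f c x)).sub h1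
    simp only [map_zero, sub_zero] at h2
    refine h2.congr' ?_
    filter_upwards [eventually_ne_atTop 0] with m hm
    have hm' : (m : ℂ) ≠ 0 := by exact_mod_cast hm
    have : f (c / m) ^ m = f c := by rw [← hpow, mul_div_cancel₀ c hm']
    simp [this]
  refine ge_of_tendsto ((hlim 1).add (hlim (-1))).norm ?_
  filter_upwards [eventually_ne_atTop 0] with m hm
  have h := norm_eval_zero_mul_le_norm_aeval
    (fun r hr x => norm_mul_norm_le_norm_sub_smul hf h0 hiso hr x)
    (fun r => re_eq_zero_of_mem_roots hm (r := r)) x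
  have e : ∀ c : ℂ, aeval D (1 + C c * X : ℂ[X]) = 1 + c • D := fun c => by
    simp [Algebra.algebraMap_eq_smul_one]
  rw [map_add, map_pow, map_pow, e, e] at h
  simp only [eval_add, eval_pow, eval_one, eval_mul, eval_C, eval_X, mul_zero, add_zero, one_pow,
    add_apply] at h
  rwa [one_add_one_eq_two, Complex.norm_two] at h

end Generator

/-! ### The norm ideal as a normed space -/

section NormIdeal

variable {H : Type*} [NormedAddCommGroup H] [InnerProductSpace ℂ H] [CompleteSpace H]

/-- The norm ideal of `N`. It is a separate type, because the ideal itself already carries the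
operator norm as a subspace of the bounded operators. -/
def NormIdeal (N : UnitarilyInvariantNorm H) : Type _ := N.ideal

namespace NormIdeal

variable (N : UnitarilyInvariantNorm H)

instance : AddCommGroup (NormIdeal N) := inferInstanceAs (AddCommGroup N.ideal)
noncomputable instance : Module ℂ (NormIdeal N) := inferInstanceAs (Module ℂ N.ideal)
noncomputable instance : Norm (NormIdeal N) := ⟨fun X => N.toSeminorm X⟩

theorem core : NormedSpace.Core ℂ (NormIdeal N) where
  norm_nonneg X := apply_nonneg N.toSeminorm X
  norm_smul c X := map_smul_eq_mul N.toSeminorm c X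
  norm_triangle X Y := map_add_le_add N.toSeminorm X Y
  norm_eq_zero_iff X :=
    ⟨N.eq_zero_of_apply_eq_zero X, fun h => by rw [h]; exact map_zero N.toSeminorm⟩

noncomputable instance : NormedAddCommGroup (NormIdeal N) := .ofCore (core N)
noncomputable instance : NormedSpace ℂ (NormIdeal N) := .ofCore (core N)

variable {N}

/-- `A X` as an element of the norm ideal. -/
def mulLeft (A : H →L[ℂ] H) (X : NormIdeal N) : NormIdeal N := ⟨A * X.1, N.mul_mem_left A X.2⟩

/-- `X B` as an element of the norm ideal. -/
def mulRight (B : H →L[ℂ] H) (X : NormIdeal N) : NormIdeal N := ⟨X.1 * B, N.mul_mem_right B X.2⟩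

theorem norm_mulLeft_unitary {U : H →L[ℂ] H} (hU : U ∈ unitary (H →L[ℂ] H)) (X : NormIdeal N) :
    ‖mulLeft U X‖ = ‖X‖ := by
  refine Eq.trans ?_ (N.apply_unitary_mul_mul_unitary U hU 1 (one_mem _) X)
  exact congrArg N.toSeminorm (Subtype.ext (mul_one _).symm)

theorem norm_mulRight_unitary {V : H →L[ℂ] H} (hV : V ∈ unitary (H →L[ℂ] H)) (X : NormIdeal N) :
    ‖mulRight V X‖ = ‖X‖ := by
  refine Eq.trans ?_ (N.apply_unitary_mul_mul_unitary 1 (one_mem _) V hV X)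
  exact congrArg N.toSeminorm (Subtype.ext (by simp [mulRight]))

/-- A linear map bounded by `K` on the unitaries satisfies `‖φ A‖ ≤ 2 ‖A‖ K`, as `A` is a
combination of four unitaries with coefficients of modulus at most `‖A‖ / 2`. -/
theorem norm_le_of_unitary {E : Type*} [SeminormedAddCommGroup E] [NormedSpace ℂ E]
    (φ : (H →L[ℂ] H) →ₗ[ℂ] E) {K : ℝ} (h : ∀ U ∈ unitary (H →L[ℂ] H), ‖φ U‖ ≤ K)
    (A : H →L[ℂ] H) : ‖φ A‖ ≤ 2 * ‖A‖ * K := by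
  have hK : 0 ≤ K := (norm_nonneg _).trans (h 1 (one_mem _))
  obtain ⟨u, c, hA, hc⟩ := CStarAlgebra.exists_sum_four_unitary A
  calc ‖φ A‖ = ‖∑ i, c i • φ (u i)‖ := by conv_lhs => rw [hA, map_sum]; simp only [map_smul]
    _ ≤ ∑ i, ‖c i • φ (u i)‖ := norm_sum_le _ _
    _ ≤ ∑ _i : Fin 4, ‖A‖ / 2 * K := by
        gcongr with i
        rw [norm_smul]
        gcongr
        · exact hc i
        · exact h _ (u i).2
    _ = 2 * ‖A‖ * K := by simp; ring

variable (N)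

/-- Left multiplication on the norm ideal, as a bilinear map. -/
noncomputable def leftMulBilin : (H →L[ℂ] H) →ₗ[ℂ] NormIdeal N →ₗ[ℂ] NormIdeal N :=
  LinearMap.mk₂ ℂ (fun A X => mulLeft A X)
    (fun _ _ _ => Subtype.ext (add_mul _ _ _)) (fun _ _ _ => Subtype.ext (smul_mul_assoc _ _ _))
    (fun _ _ _ => Subtype.ext (mul_add _ _ _)) (fun _ _ _ => Subtype.ext (mul_smul_comm _ _ _))

/-- Right multiplication on the norm ideal, as a bilinear map with the multiplier first. -/
noncomputable def rightMulBilin : (H →L[ℂ] H) →ₗ[ℂ] NormIdeal N →ₗ[ℂ] NormIdeal N :=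
  LinearMap.mk₂ ℂ (fun B X => mulRight B X)
    (fun _ _ _ => Subtype.ext (mul_add _ _ _)) (fun _ _ _ => Subtype.ext (mul_smul_comm _ _ _))
    (fun _ _ _ => Subtype.ext (add_mul _ _ _)) (fun _ _ _ => Subtype.ext (smul_mul_assoc _ _ _))

theorem norm_leftMulBilin_le (A : H →L[ℂ] H) (X : NormIdeal N) :
    ‖leftMulBilin N A X‖ ≤ 2 * ‖A‖ * ‖X‖ :=
  norm_le_of_unitary ((leftMulBilin N).flip X) (fun _ hU => (norm_mulLeft_unitary hU X).le) A

theorem norm_rightMulBilin_le (B : H →L[ℂ] H) (X : NormIdeal N) :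
    ‖rightMulBilin N B X‖ ≤ 2 * ‖B‖ * ‖X‖ :=
  norm_le_of_unitary ((rightMulBilin N).flip X) (fun _ hV => (norm_mulRight_unitary hV X).le) B

/-- Left multiplication on the norm ideal, as a bounded linear function of the multiplier. -/
noncomputable def leftMul : (H →L[ℂ] H) →L[ℂ] NormIdeal N →L[ℂ] NormIdeal N :=
  (leftMulBilin N).mkContinuous₂ 2 (norm_leftMulBilin_le N)

/-- Right multiplication on the norm ideal, as a bounded linear function of the multiplier. -/
noncomputable def rightMul : (H →L[ℂ] H) →L[ℂ] NormIdeal N →L[ℂ] NormIdeal N :=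
  (rightMulBilin N).mkContinuous₂ 2 (norm_rightMulBilin_le N)

theorem leftMul_apply (A : H →L[ℂ] H) (X : NormIdeal N) : leftMul N A X = mulLeft A X := rfl

theorem rightMul_apply (B : H →L[ℂ] H) (X : NormIdeal N) : rightMul N B X = mulRight B X := rfl

/-- The family of operators `X ↦ exp (z a) X exp (-z b)` on the norm ideal. -/
noncomputable def expFlow (a b : H →L[ℂ] H) (z : ℂ) : NormIdeal N →L[ℂ] NormIdeal N :=
  leftMul N (NormedSpace.exp (z • a)) * rightMul N (NormedSpace.exp (z • (-b)))

variable (a b : H →L[ℂ] H)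

theorem expFlow_apply_val (z : ℂ) (X : NormIdeal N) :
    (expFlow N a b z X).1 =
      NormedSpace.exp (z • a) * (X.1 * NormedSpace.exp (z • (-b))) := rfl

theorem expFlow_zero : expFlow N a b 0 = 1 := by
  ext X
  exact Subtype.ext (by simp [expFlow_apply_val])

theorem exp_add_smul (c : H →L[ℂ] H) (z w : ℂ) :
    NormedSpace.exp ((z + w) • c) = NormedSpace.exp (z • c) * NormedSpace.exp (w • c) := by
  let _ : NormedAlgebra ℚ (H →L[ℂ] H) := .restrictScalars ℚ ℂ (H →L[ℂ] H)
  rw [add_smul]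
  exact NormedSpace.exp_add_of_commute (((Commute.refl c).smul_left z).smul_right w)

theorem expFlow_add (z w : ℂ) : expFlow N a b (z + w) = expFlow N a b z * expFlow N a b w := by
  ext X
  refine Subtype.ext ?_
  rw [mul_apply_eq_comp, expFlow_apply_val, expFlow_apply_val, expFlow_apply_val,
    exp_add_smul, add_comm z w, exp_add_smul]
  simp only [mul_assoc]

theorem expFlow_nat_mul (n : ℕ) (z : ℂ) : expFlow N a b (n * z) = expFlow N a b z ^ n := by
  induction n with
  | zero => simp [expFlow_zero]
  | succ n ih => rw [Nat.cast_succ, add_mul, one_mul, expFlow_add, ih, pow_succ]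

theorem exists_hasDerivAt_expFlow : ∃ D, HasDerivAt (expFlow N a b) D 0 :=
  ⟨_, ((leftMul N).hasFDerivAt.comp_hasDerivAt (0 : ℂ) (hasDerivAt_exp_smul_const a (0 : ℂ))).mul
    ((rightMul N).hasFDerivAt.comp_hasDerivAt (0 : ℂ) (hasDerivAt_exp_smul_const (-b) (0 : ℂ)))⟩

variable {a b}

theorem exp_imaginary_smul_mem_unitary {c : H →L[ℂ] H} (hc : IsSelfAdjoint c) (s : ℝ) :
    NormedSpace.exp ((s * Complex.I : ℂ) • c) ∈ unitary (H →L[ℂ] H) := by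
  let _ : NormedAlgebra ℚ (H →L[ℂ] H) := .restrictScalars ℚ ℂ (H →L[ℂ] H)
  refine NormedSpace.exp_mem_unitary_of_mem_skewAdjoint (hc.smul_mem_skewAdjoint ?_)
  simp [skewAdjoint.mem_iff]

theorem norm_expFlow_imaginary (ha : IsSelfAdjoint a) (hb : IsSelfAdjoint b) (s : ℝ)
    (X : NormIdeal N) : ‖expFlow N a b (s * Complex.I) X‖ = ‖X‖ := by
  rw [expFlow, mul_apply_eq_comp, leftMul_apply, rightMul_apply,
    norm_mulLeft_unitary (exp_imaginary_smul_mem_unitary ha s),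
    norm_mulRight_unitary (exp_imaginary_smul_mem_unitary hb.neg s)]

theorem two_mul_norm_le_norm_expFlow_add (ha : IsSelfAdjoint a) (hb : IsSelfAdjoint b)
    (X : NormIdeal N) : 2 * ‖X‖ ≤ ‖expFlow N a b 1 X + expFlow N a b (-1) X‖ := by
  obtain ⟨D, hD⟩ := exists_hasDerivAt_expFlow N a b
  exact two_mul_norm_le_norm_add hD (expFlow_zero N a b) (expFlow_nat_mul N a b)
    (norm_expFlow_imaginary N ha hb) X

/-- The case `t = 2`: the operator `f 2 + f (-2) + 2` is the square of `f 1 + f (-1)`. -/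
theorem four_mul_norm_le (ha : IsSelfAdjoint a) (hb : IsSelfAdjoint b) (X : NormIdeal N) :
    4 * ‖X‖ ≤ ‖expFlow N a b 2 X + expFlow N a b (-2) X + (2 : ℂ) • X‖ := by
  have h1 := two_mul_norm_le_norm_expFlow_add N ha hb X
  have h2 := two_mul_norm_le_norm_expFlow_add N ha hb (expFlow N a b 1 X + expFlow N a b (-1) X)
  have e : ∀ z w, expFlow N a b z (expFlow N a b w X) = expFlow N a b (z + w) X := fun z w => by
    rw [expFlow_add]; rfl
  have h3 : expFlow N a b 1 (expFlow N a b 1 X + expFlow N a b (-1) X)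
        + expFlow N a b (-1) (expFlow N a b 1 X + expFlow N a b (-1) X)
      = expFlow N a b 2 X + expFlow N a b (-2) X + (2 : ℂ) • X := by
    rw [map_add, map_add, e, e, e, e]
    norm_num [expFlow_zero, two_smul]
    abel
  rw [h3] at h2
  linarith

end NormIdeal

/-- An invertible positive operator is the square of the exponential of a self-adjoint one. -/
theorem exists_isSelfAdjoint_exp_two_smul (P : (H →L[ℂ] H)ˣ) (hP : (P : H →L[ℂ] H).IsPositive) :
    ∃ a : H →L[ℂ] H, IsSelfAdjoint a ∧ NormedSpace.exp ((2 : ℂ) • a) = P ∧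
      NormedSpace.exp ((-2 : ℂ) • a) = (P⁻¹ : (H →L[ℂ] H)ˣ) := by
  have hpos : IsStrictlyPositive (P : H →L[ℂ] H) :=
    P.isUnit.isStrictlyPositive ((ContinuousLinearMap.nonneg_iff_isPositive _).2 hP)
  have hexp : NormedSpace.exp ((2 : ℂ) • (2⁻¹ : ℝ) • CFC.log (P : H →L[ℂ] H)) = P := by
    rw [← Complex.coe_smul, smul_smul]
    norm_num
    exact CFC.exp_log _ hpos
  refine ⟨(2⁻¹ : ℝ) • CFC.log (P : H →L[ℂ] H), (IsSelfAdjoint.all _).smul IsSelfAdjoint.log,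
    hexp, ?_⟩
  refine (Units.inv_eq_of_mul_eq_one_right ?_).symm
  nth_rewrite 1 [← hexp]
  rw [← NormIdeal.exp_add_smul]
  simp

end NormIdeal

theorem mainTheorem2 {H : Type*} [NormedAddCommGroup H] [InnerProductSpace ℂ H]
    [CompleteSpace H] (P Q : (H →L[ℂ] H)ˣ)
    (hP : (P : H →L[ℂ] H).IsPositive) (hQ : (Q : H →L[ℂ] H).IsPositive)
    (t : ℝ) (ht : t ≤ 2) (N : UnitarilyInvariantNorm H) (X : N.ideal) :
    N (N.mulMul (P : H →L[ℂ] H) X ((Q⁻¹ : (H →L[ℂ] H)ˣ) : H →L[ℂ] H)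
        + N.mulMul ((P⁻¹ : (H →L[ℂ] H)ˣ) : H →L[ℂ] H) X (Q : H →L[ℂ] H)
        + (t : ℂ) • X)
      ≥ (t + 2) * N X := by

  obtain ⟨a, ha, hPa, hPa'⟩ := exists_isSelfAdjoint_exp_two_smul P hP
  obtain ⟨b, hb, hQb, hQb'⟩ := exists_isSelfAdjoint_exp_two_smul Q hQ
  set S : N.ideal := N.mulMul (P : H →L[ℂ] H) X ((Q⁻¹ : (H →L[ℂ] H)ˣ) : H →L[ℂ] H)
    + N.mulMul ((P⁻¹ : (H →L[ℂ] H)ˣ) : H →L[ℂ] H) X (Q : H →L[ℂ] H)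
  have key : 4 * N X ≤ N (S + (2 : ℂ) • X) := by
    have h := NormIdeal.four_mul_norm_le N ha hb X
    have e1 : NormIdeal.expFlow N a b 2 X
        = N.mulMul (P : H →L[ℂ] H) X ((Q⁻¹ : (H →L[ℂ] H)ˣ) : H →L[ℂ] H) := by
      refine Subtype.ext ((NormIdeal.expFlow_apply_val N a b 2 X).trans ?_)
      rw [smul_neg, ← neg_smul, hPa, hQb']
      exact (mul_assoc _ _ _).symm
    have e2 : NormIdeal.expFlow N a b (-2) X
        = N.mulMul ((P⁻¹ : (H →L[ℂ] H)ˣ) : H →L[ℂ] H) X (Q : H →L[ℂ] H) := by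
      refine Subtype.ext ((NormIdeal.expFlow_apply_val N a b (-2) X).trans ?_)
      rw [smul_neg, ← neg_smul, neg_neg, hPa', hQb]
      exact (mul_assoc _ _ _).symm
    rw [e1, e2] at h
    exact h
  have htri : N (S + (2 : ℂ) • X) ≤ N (S + (t : ℂ) • X) + (2 - t) * N X := by
    have e : S + (2 : ℂ) • X = (S + (t : ℂ) • X) + ((2 - t : ℝ) : ℂ) • X := by
      push_cast
      module
    rw [e]
    refine (map_add_le_add N.toSeminorm _ _).trans_eq ?_
    rw [map_smul_eq_mul, Complex.norm_real, Real.norm_of_nonneg (sub_nonneg.2 ht)]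
  linarith
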